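/- **Theorem 4.4.** Let $\bar I_1,\bar I_2,\bar I_3,J_3>0$ be the (effective) moments of inertia of a rigid spacecraft with an internal rotor, with coincident centers of buoyancy and gravity. Let $Q=\mathrm{SO}(3)\times\mathbb R\ni(A,\alpha)$ with bundle projection $\pi_Q:T^*Q\to Q$. Identify $\mathfrak{so}(3)\cong\mathfrak{so}^*(3)\cong\mathbb R^3$ and, by left trivialization, $T^*Q\cong \mathrm{SO}(3)\times\mathfrak{so}^*(3)\times\mathbb R\times\mathbb R^*\ni(A,\Pi,\alpha,l)$, with the canonical symplectic form $\omega_Q$ and $$H(A,\Pi,\alpha,l)=\tfrac12\Big[\tfrac{\Pi_1^2}{\bar I_1}+\tfrac{\Pi_2^2}{\bar I_2}+\tfrac{(\Pi_3-l)^2}{\bar I_3}+\tfrac{l^2}{J_3}\Big].$$ Let $\mathrm{SO}(3)$ act by $B\cdot(A,\alpha)=(BA,\alpha)$ on $Q$ and by the cotangent lift $B\cdot(A,\Pi,\alpha,l)=(BA,\Pi,\alpha,l)$ on $T^*Q$, with momentum map $\mathbf J_Q(A,\Pi,\alpha,l)=A\Pi$. Let $u:T^*Q\to T^*Q$ be a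 smooth fiber-preserving $\mathrm{SO}(3)$-equivariant control, and let $\tilde X=X_H+\mathrm{vlift}(u)$ be the dynamical vector field of the controlled system, where $\mathrm{vlift}(u)(z)$ is the velocity at $t=0$ of $t\mapsto z+t\,u(z)$ in the fiber of $T^*Q$. Let $\mu\in\mathfrak{so}^*(3)$ (every $\mu$ is a regular value of $\mathbf J_Q$), let $\mathrm{SO}(3)_\mu$ be its coadjoint isotropy group and $\mathcal O_\mu$ its coadjoint orbit. The reduced space is $\mathcal O_\mu\times\mathbb R\times\mathbb R^*$ with the symplectic form $\tilde\omega^-=\pi^*_{\mathcal O_\mu}\omega^-_{\mathcal O_\mu}+\pi^*_{\mathbb R}\omega_{\mathbb R}$, the reduction map is $\pi_\mu:\mathbf J_Q^{-1}(\mu)\to\mathcal O_\mu\times\mathbb R\times\mathbb R^*$, $(A,\Pi,\alpha,l)\mapsto(\Pi,\alpha,l)$, the reduced Hamiltonian $h_\mu$ is given by $h_\mu\circ\pi_\mu=H|_{\mathbf J_Q^{-1}(\mu)}$, and $X_{h_\mu}$ is its Hamiltonian vector field with respect to $\tilde\omega^-$. Let $\gamma:Q\to T^*Q$ be a smooth one-form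 that is $\mathrm{SO}(3)_\mu$-equivariant with $\operatorname{Im}\gamma\subset\mathbf J_Q^{-1}(\mu)$, and let $\varepsilon:T^*Q\to T^*Q$ be a smooth $\mathrm{SO}(3)_\mu$-equivariant symplectic map with $\varepsilon(\mathbf J_Q^{-1}(\mu))\subset\mathbf J_Q^{-1}(\mu)$. Put $\bar\gamma=\pi_\mu\circ\gamma$, $\bar\varepsilon=\pi_\mu\circ\varepsilon|_{\mathbf J_Q^{-1}(\mu)}$ and $\tilde X^\varepsilon=T\pi_Q\circ\tilde X\circ\varepsilon$. Then: 1. the Type II Hamilton–Jacobi equation $T\gamma\cdot\tilde X^\varepsilon=X_H\cdot\varepsilon$ holds on $T^*Q$ if and only if the reduced Type II Hamilton–Jacobi equation $T\bar\gamma\cdot\tilde X^\varepsilon=X_{h_\mu}\cdot\bar\varepsilon$ holds on $\mathbf J_Q^{-1}(\mu)$; 2. at every single point $z\in\mathbf J_Q^{-1}(\mu)$, $T\gamma\cdot\tilde X^\varepsilon(z)=X_H(\varepsilon(z))$ if and only if $T\bar\gamma\cdot\tilde X^\varepsilon(z)=X_{h_\mu}(\bar\varepsilon(z))$. -/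

import Mathlib

open scoped Manifold ContDiff Matrix

namespace SpacecraftRotor

noncomputable section

/-- The rotation group `SO(3)`. -/
abbrev SO3 : Type := Matrix.specialOrthogonalGroup (Fin 3) ℝ

/-- `ℝ³`, used for both `so(3)` and `so*(3)`: the bracket of `so(3)` is the cross product and the
pairing is the dot product. -/
abbrev R3 : Type := Fin 3 → ℝ

/-- The skew matrix `x^` with `x^ y = x × y`. -/
def hat (x : R3) : Matrix (Fin 3) (Fin 3) ℝ :=
  !![0, -x 2, x 1; x 2, 0, -x 0; -x 1, x 0, 0]

theorem hat_mulVec (x y : R3) : hat x *ᵥ y = crossProduct x y := by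
  ext i
  fin_cases i <;> simp [hat, Matrix.mulVec, dotProduct, Fin.sum_univ_three, cross_apply] <;> ring

/-- The Cayley transform `(1 + x^/2)(1 - x^/2)⁻¹ ∈ SO(3)` of `x ∈ ℝ³`, written out. -/
def cayleyMatrix (x : R3) : Matrix (Fin 3) (Fin 3) ℝ := fun i j =>
  ((4 - x ⬝ᵥ x) * (1 : Matrix (Fin 3) (Fin 3) ℝ) i j + 2 * x i * x j + 4 * hat x i j)
    / (4 + x ⬝ᵥ x)

/-- The inverse of `cayleyMatrix` on rotations `R` with `1 + tr R ≠ 0`. -/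
def cayleyCoord (R : Matrix (Fin 3) (Fin 3) ℝ) : R3 :=
  (2 / (1 + R.trace)) • ![R 2 1 - R 1 2, R 0 2 - R 2 0, R 1 0 - R 0 1]

theorem four_add_pos (x : R3) : 0 < 4 + x ⬝ᵥ x := by
  have : 0 ≤ x ⬝ᵥ x := by
    simp only [dotProduct, Fin.sum_univ_three]
    nlinarith [mul_self_nonneg (x 0), mul_self_nonneg (x 1), mul_self_nonneg (x 2)]
  linarith

theorem cayleyMatrix_mem (x : R3) :
    cayleyMatrix x ∈ Matrix.specialOrthogonalGroup (Fin 3) ℝ := by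
  have h := (four_add_pos x).ne'
  rw [Matrix.mem_specialOrthogonalGroup_iff, Matrix.mem_orthogonalGroup_iff]
  simp only [dotProduct, Fin.sum_univ_three] at h
  constructor
  · ext i j
    fin_cases i <;> fin_cases j <;>
      simp [cayleyMatrix, hat, Matrix.mul_apply, Fin.sum_univ_three, dotProduct] <;> field_simp <;> ring
  · rw [Matrix.det_fin_three]
    simp [cayleyMatrix, hat, Fin.sum_univ_three, dotProduct]
    field_simp
    ring

theorem trace_cayleyMatrix (x : R3) : 1 + (cayleyMatrix x).trace = 16 / (4 + x ⬝ᵥ x) := by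
  have h := (four_add_pos x).ne'
  simp only [dotProduct, Fin.sum_univ_three] at h
  simp [Matrix.trace, cayleyMatrix, hat, Fin.sum_univ_three, dotProduct]
  field_simp
  ring

theorem cayleyCoord_cayleyMatrix (x : R3) : cayleyCoord (cayleyMatrix x) = x := by
  have h := (four_add_pos x).ne'
  rw [cayleyCoord, trace_cayleyMatrix]
  simp only [dotProduct, Fin.sum_univ_three] at h
  ext i
  fin_cases i <;> simp [cayleyMatrix, hat, Fin.sum_univ_three, dotProduct] <;> field_simp <;> ring

theorem cayleyMatrix_cayleyCoord {R : Matrix (Fin 3) (Fin 3) ℝ}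
    (hR : R ∈ Matrix.specialOrthogonalGroup (Fin 3) ℝ) (ht : 1 + R.trace ≠ 0) :
    cayleyMatrix (cayleyCoord R) = R := by
  rw [Matrix.mem_specialOrthogonalGroup_iff] at hR
  obtain ⟨h0, hd⟩ := hR
  have h1 := (Matrix.mem_orthogonalGroup_iff _ _).1 h0
  have h2 := (Matrix.mem_orthogonalGroup_iff' _ _).1 h0
  have hadj : R.adjugate = Rᵀ := by
    have := congrArg (fun M => Rᵀ * M) (Matrix.mul_adjugate R)
    simpa [← mul_assoc, h2, hd] using this
  have e1 := fun i j => congrFun (congrFun h1 i) j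
  have e2 := fun i j => congrFun (congrFun h2 i) j
  have e3 := fun i j => congrFun (congrFun hadj i) j
  simp only [Matrix.adjugate_fin_three] at e3
  simp only [Fin.forall_fin_succ, Matrix.mul_apply, Fin.sum_univ_three, Matrix.transpose_apply] at e1 e2 e3
  simp at e1 e2 e3
  have htr : R.trace = R 0 0 + R 1 1 + R 2 2 := by simp [Matrix.trace, Fin.sum_univ_three]
  rw [htr] at ht
  have key : 4 + cayleyCoord R ⬝ᵥ cayleyCoord R = 16 / (1 + R.trace) := by
    simp [cayleyCoord, dotProduct, Fin.sum_univ_three, htr]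
    field_simp
    grind
  have key' : 4 - cayleyCoord R ⬝ᵥ cayleyCoord R = 8 - 16 / (1 + R.trace) := by linarith
  ext i j
  rw [cayleyMatrix, key, key', htr]
  fin_cases i <;> fin_cases j <;> simp [cayleyCoord, hat, htr] <;> field_simp <;> grind

theorem contDiff_cayleyMatrix (i j : Fin 3) : ContDiff ℝ ∞ (fun x : R3 => cayleyMatrix x i j) := by
  unfold cayleyMatrix
  refine ContDiff.div ?_ ?_ (fun x => (four_add_pos x).ne')
  · fin_cases i <;> fin_cases j <;> simp [hat, dotProduct, Fin.sum_univ_three] <;> fun_prop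
  · simp only [dotProduct, Fin.sum_univ_three]; fun_prop

theorem continuous_cayleyMatrix : Continuous cayleyMatrix :=
  continuous_matrix fun i j => (contDiff_cayleyMatrix i j).continuous

/-- Cayley chart of `SO(3)` centred at `A`. -/
def cayleyChart (A : SO3) : OpenPartialHomeomorph SO3 R3 where
  toFun B := cayleyCoord ((A⁻¹ * B : SO3) : Matrix (Fin 3) (Fin 3) ℝ)
  invFun x := A * ⟨cayleyMatrix x, cayleyMatrix_mem x⟩
  source := {B | 1 + ((A⁻¹ * B : SO3) : Matrix (Fin 3) (Fin 3) ℝ).trace ≠ 0}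
  target := Set.univ
  map_source' _ _ := Set.mem_univ _
  map_target' x _ := by
    have h := (four_add_pos x).ne'
    simp only [inv_mul_cancel_left, Set.mem_ofPred_eq, trace_cayleyMatrix]
    exact div_ne_zero (by norm_num) h
  left_inv' B hB := by
    rw [mul_eq_of_eq_inv_mul]
    exact Subtype.ext (cayleyMatrix_cayleyCoord (A⁻¹ * B).2 hB)
  right_inv' x _ := by
    simp [cayleyCoord_cayleyMatrix]
  open_source := by
    refine isOpen_ne_fun ?_ continuous_const
    have : Continuous fun B : SO3 => ((A⁻¹ : SO3) : Matrix (Fin 3) (Fin 3) ℝ) * B.1 := by fun_prop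
    exact continuous_const.add (Continuous.matrix_trace this)
  open_target := isOpen_univ
  continuousOn_toFun := by
    have h : Continuous fun B : SO3 => ((A⁻¹ : SO3) : Matrix (Fin 3) (Fin 3) ℝ) * B.1 := by fun_prop
    have h' := fun i j => h.matrix_elem i j
    refine ContinuousOn.smul (ContinuousOn.div continuousOn_const
      (continuous_const.add (Continuous.matrix_trace h)).continuousOn fun B hB => hB) ?_
    refine Continuous.continuousOn (continuous_pi fun i => ?_)
    fin_cases i
    · exact (h' 2 1).sub (h' 1 2)
    · exact (h' 0 2).sub (h' 2 0)
    · exact (h' 1 0).sub (h' 0 1)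
  continuousOn_invFun := by
    refine Continuous.continuousOn (Continuous.subtype_mk (f := fun x => A.1 * cayleyMatrix x) ?_ _)
    exact continuous_const.matrix_mul continuous_cayleyMatrix

/-- The smooth structure of `SO(3)`; the preferred chart at `A` is the Cayley chart centred there. -/
instance : ChartedSpace R3 SO3 where
  atlas := Set.range cayleyChart
  chartAt := cayleyChart
  mem_chart_source A := by
    have : (1 : ℝ) + ((1 : SO3) : Matrix (Fin 3) (Fin 3) ℝ).trace ≠ 0 := by simp; norm_num
    simpa only [cayleyChart, Set.mem_ofPred_eq, inv_mul_cancel] using this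
  chart_mem_atlas A := ⟨A, rfl⟩

instance : IsManifold 𝓘(ℝ, R3) ∞ SO3 := by
  refine isManifold_of_contDiffOn _ _ _ ?_
  rintro _ _ ⟨A, rfl⟩ ⟨B, rfl⟩
  have h : ∀ i j, ContDiff ℝ ∞ (fun x : R3 =>
      (((B⁻¹ * A : SO3) : Matrix (Fin 3) (Fin 3) ℝ) * cayleyMatrix x) i j) := by
    intro i j
    simp only [Matrix.mul_apply]
    exact ContDiff.sum fun k _ => contDiff_const.mul (contDiff_cayleyMatrix k j)
  have hs : ContDiffOn ℝ ∞ (fun x : R3 =>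
      cayleyCoord (((B⁻¹ * A : SO3) : Matrix (Fin 3) (Fin 3) ℝ) * cayleyMatrix x))
      {x | 1 + (((B⁻¹ * A : SO3) : Matrix (Fin 3) (Fin 3) ℝ) * cayleyMatrix x).trace ≠ 0} := by
    refine ContDiffOn.smul
      (f := fun x : R3 => 2 / (1 + (((B⁻¹ * A : SO3) : Matrix (Fin 3) (Fin 3) ℝ)
        * cayleyMatrix x).trace))
      (ContDiffOn.div contDiffOn_const ?_ fun x hx => hx) ?_
    · refine ContDiff.contDiffOn (contDiff_const.add ?_)
      simp only [Matrix.trace, Matrix.diag]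
      exact ContDiff.sum fun k _ => h k k
    · refine ContDiff.contDiffOn (contDiff_pi.2 fun i => ?_)
      fin_cases i
      · exact (h 2 1).sub (h 1 2)
      · exact (h 0 2).sub (h 2 0)
      · exact (h 1 0).sub (h 0 1)
  have hf : ∀ x, (𝓘(ℝ, R3) ∘ (cayleyChart A).symm ≫ₕ cayleyChart B ∘ 𝓘(ℝ, R3).symm) x =
      cayleyCoord (((B⁻¹ * A : SO3) : Matrix (Fin 3) (Fin 3) ℝ) * cayleyMatrix x) := by
    intro x
    simp [cayleyChart, mul_assoc]
  refine ContDiffOn.congr (hs.mono ?_) fun x _ => hf x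
  intro x hx
  simpa [cayleyChart, mul_assoc] using hx

/-- The linear functional `ξ ↦ (ξ^)_{kl}`. -/
def hatEntry (k l : Fin 3) : R3 →L[ℝ] ℝ :=
  LinearMap.toContinuousLinearMap
    { toFun := fun ξ : R3 => hat ξ k l
      map_add' := by
        intro x y; fin_cases k <;> fin_cases l <;> simp [hat] <;> ring
      map_smul' := by
        intro c x; simp only [RingHom.id_apply]; fin_cases k <;> fin_cases l <;> simp [hat] }

theorem hatEntry_apply (k l : Fin 3) (ξ : R3) : hatEntry k l ξ = hat ξ k l := rfl

/-- In the preferred chart at `A` a tangent vector `ξ ∈ ℝ³` of `SO(3)` is the matrix `A ξ^`: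
the tangent spaces `TangentSpace 𝓘(ℝ, ℝ³) A = ℝ³` are left-trivialized. -/
theorem mfderiv_entry (A : SO3) (i j : Fin 3) (ξ : R3) :
    mfderiv 𝓘(ℝ, R3) 𝓘(ℝ, ℝ) (fun B : SO3 => (B : Matrix (Fin 3) (Fin 3) ℝ) i j) A ξ
      = ((A : Matrix (Fin 3) (Fin 3) ℝ) * hat ξ) i j := by
  have hc : ∀ k l, HasFDerivAt (fun x : R3 => cayleyMatrix x k l)
      (hatEntry k l) 0 := by
    intro k l
    have hd : DifferentiableAt ℝ (fun x : R3 => cayleyMatrix x k l) 0 :=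
      (contDiff_cayleyMatrix k l).differentiable (by simp) 0
    refine hd.hasFDerivAt.congr_fderiv ?_
    ext1 x
    have h1 : HasDerivAt (fun t : ℝ => t • x) x 0 := by
      simpa using (hasDerivAt_id (0 : ℝ)).smul_const x
    have h0 : HasFDerivAt (fun x : R3 => cayleyMatrix x k l)
        (fderiv ℝ (fun x : R3 => cayleyMatrix x k l) 0) ((0 : ℝ) • x) := by
      rw [zero_smul]; exact hd.hasFDerivAt
    have h2 := h0.comp_hasDerivAt (0 : ℝ) h1
    refine h2.unique ?_
    have hnum : HasDerivAt (fun t : ℝ => (4 - t ^ 2 * (x ⬝ᵥ x)) * (1 : Matrix (Fin 3) (Fin 3) ℝ) k l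
        + t ^ 2 * (2 * x k * x l) + t * (4 * hat x k l)) (4 * hat x k l) 0 := by
      have ha : HasDerivAt (fun t : ℝ => t ^ 2) 0 0 := by simpa using hasDerivAt_pow 2 (0 : ℝ)
      have := ((((ha.mul_const (x ⬝ᵥ x)).const_sub 4).mul_const
        ((1 : Matrix (Fin 3) (Fin 3) ℝ) k l)).add (ha.mul_const (2 * x k * x l))).add
        ((hasDerivAt_id (0 : ℝ)).mul_const (4 * hat x k l))
      refine (this.congr_deriv (by simp)).congr_of_eventuallyEq
        (Filter.Eventually.of_forall fun t => ?_)
      simp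
    have hden : HasDerivAt (fun t : ℝ => 4 + t ^ 2 * (x ⬝ᵥ x)) 0 0 := by
      have ha : HasDerivAt (fun t : ℝ => t ^ 2) 0 0 := by simpa using hasDerivAt_pow 2 (0 : ℝ)
      simpa using (ha.mul_const (x ⬝ᵥ x)).const_add 4
    have hq := hnum.div hden (by norm_num)
    refine (hq.congr_deriv ?_).congr_of_eventuallyEq (Filter.Eventually.of_forall fun t => ?_)
    · simp [hatEntry_apply]; ring
    · have hh : hat (t • x) k l = t * hat x k l := by
        fin_cases k <;> fin_cases l <;> simp [hat]
      simp [cayleyMatrix, hh]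
      ring
  have hE : HasFDerivAt (fun x : R3 => ((A : Matrix (Fin 3) (Fin 3) ℝ) * cayleyMatrix x) i j)
      (∑ k, (A : Matrix (Fin 3) (Fin 3) ℝ) i k • (hatEntry k j)) 0 := by
    simp only [Matrix.mul_apply]
    exact HasFDerivAt.fun_sum fun k _ => (hc k j).const_mul _
  have hA : cayleyChart A A = 0 := by
    have : cayleyCoord ((1 : SO3) : Matrix (Fin 3) (Fin 3) ℝ) = 0 := by
      ext i; fin_cases i <;> simp [cayleyCoord]
    rw [← inv_mul_cancel A] at this
    exact this
  have hm : HasMFDerivAt 𝓘(ℝ, R3) 𝓘(ℝ, ℝ)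
      (fun B : SO3 => (B : Matrix (Fin 3) (Fin 3) ℝ) i j) A
      (∑ k, (A : Matrix (Fin 3) (Fin 3) ℝ) i k • (hatEntry k j)) := by
    refine ⟨(Continuous.matrix_elem continuous_subtype_val i j).continuousAt, ?_⟩
    have : extChartAt 𝓘(ℝ, R3) A A = 0 := hA
    rw [this]
    exact hE.hasFDerivWithinAt
  rw [hm.mfderiv]
  change (∑ k, (A : Matrix (Fin 3) (Fin 3) ℝ) i k • hatEntry k j) ξ = _
  simp [Matrix.mul_apply, hatEntry_apply]

/-! ### Configuration space, phase space, canonical symplectic form -/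

/-- The configuration space `Q = SO(3) × ℝ`, with points `(A, α)`. -/
abbrev Config : Type := SO3 × ℝ

/-- The vector space `so*(3) × ℝ × ℝ*`, with points `(Π, α, l)`. -/
abbrev DualSpace : Type := R3 × ℝ × ℝ

/-- The left-trivialized cotangent bundle
`T*Q = SO(3) × so*(3) × ℝ × ℝ*`, with points `(A, Π, α, l)`. -/
abbrev Phase : Type := SO3 × DualSpace

abbrev IQ : ModelWithCorners ℝ (R3 × ℝ) (ModelProd R3 ℝ) := 𝓘(ℝ, R3).prod 𝓘(ℝ, ℝ)

abbrev IP : ModelWithCorners ℝ (R3 × DualSpace) (ModelProd R3 DualSpace) :=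
  𝓘(ℝ, R3).prod 𝓘(ℝ, DualSpace)

/-- The bundle projection `π_Q : T*Q → Q`. -/
def piQ (z : Phase) : Config := (z.1, z.2.2.1)

/-- The left action of `SO(3)` on `Q`. -/
def actQ (g : SO3) (q : Config) : Config := (g * q.1, q.2)

/-- The cotangent lift of the left action, in the left trivialization. -/
def actP (g : SO3) (z : Phase) : Phase := (g * z.1, z.2)

/-- The canonical symplectic form `ω_Q = -dθ` of `T*Q` in the left trivialization, where
`θ(ξ, ρ, a, b) = ⟨Π, ξ⟩ + l a`. A tangent vector `(ξ, ρ, a, b)` at `(A, Π, α, l)` is the velocity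
`(A ξ^, ρ, a, b)`. -/
def canonicalForm (z : Phase) (v w : R3 × DualSpace) : ℝ :=
  v.1 ⬝ᵥ w.2.1 - w.1 ⬝ᵥ v.2.1 + z.2.1 ⬝ᵥ crossProduct v.1 w.1
    + (v.2.2.1 * w.2.2.2 - v.2.2.2 * w.2.2.1)

theorem canonicalForm_nondegenerate (z : Phase) (L : R3 × DualSpace →L[ℝ] ℝ) :
    ∃! X : R3 × DualSpace, ∀ w, canonicalForm z X w = L w := by
  have hL : ∀ w : R3 × DualSpace, L w
      = w.1 ⬝ᵥ (fun i => L (Pi.single i 1, 0, 0, 0))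
        + w.2.1 ⬝ᵥ (fun i => L (0, Pi.single i 1, 0, 0))
        + w.2.2.1 * L (0, 0, 1, 0) + w.2.2.2 * L (0, 0, 0, 1) := by
    intro w
    have hw : w = w.1 0 • ((Pi.single 0 1 : R3), (0 : R3), (0 : ℝ), (0 : ℝ))
        + w.1 1 • ((Pi.single 1 1 : R3), (0 : R3), (0 : ℝ), (0 : ℝ))
        + w.1 2 • ((Pi.single 2 1 : R3), (0 : R3), (0 : ℝ), (0 : ℝ))
        + w.2.1 0 • ((0 : R3), (Pi.single 0 1 : R3), (0 : ℝ), (0 : ℝ))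
        + w.2.1 1 • ((0 : R3), (Pi.single 1 1 : R3), (0 : ℝ), (0 : ℝ))
        + w.2.1 2 • ((0 : R3), (Pi.single 2 1 : R3), (0 : ℝ), (0 : ℝ))
        + w.2.2.1 • ((0 : R3), (0 : R3), (1 : ℝ), (0 : ℝ))
        + w.2.2.2 • ((0 : R3), (0 : R3), (0 : ℝ), (1 : ℝ)) := by
      refine Prod.ext ?_ (Prod.ext ?_ (Prod.ext ?_ ?_))
      · ext i; fin_cases i <;> simp
      · ext i; fin_cases i <;> simp
      · simp
      · simp
    conv_lhs => rw [hw]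
    simp only [map_add, map_smul, smul_eq_mul, dotProduct, Fin.sum_univ_three]
    ring
  refine ⟨(fun i => L (0, Pi.single i 1, 0, 0),
    crossProduct z.2.1 (fun i => L (0, Pi.single i 1, 0, 0))
      - fun i => L (Pi.single i 1, 0, 0, 0), L (0, 0, 0, 1), - L (0, 0, 1, 0)), ?_, ?_⟩
  · intro w
    rw [hL w]
    simp only [canonicalForm, dotProduct, Fin.sum_univ_three, cross_apply, Pi.sub_apply,
      Matrix.cons_val_zero, Matrix.cons_val_one, Matrix.cons_val]
    ring
  · intro X hX
    have h1 : ∀ i, X.1 i = L (0, Pi.single i 1, 0, 0) := by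
      intro i
      simpa [canonicalForm] using hX (0, Pi.single i 1, 0, 0)
    have h2 : ∀ i, X.2.1 i = crossProduct z.2.1 (fun i => L (0, Pi.single i 1, 0, 0)) i
        - L (Pi.single i 1, 0, 0, 0) := by
      intro i
      have h := hX (Pi.single i 1, 0, 0, 0)
      rw [← h, ← funext h1]
      fin_cases i <;>
        simp [canonicalForm, cross_apply, dotProduct, Fin.sum_univ_three, Pi.single_apply] <;> ring
    have h3 : X.2.2.1 = L (0, 0, 0, 1) := by
      simpa [canonicalForm] using hX (0, 0, 0, 1)
    have h4 : X.2.2.2 = - L (0, 0, 1, 0) := by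
      rw [← hX (0, 0, 1, 0)]; simp [canonicalForm]
    refine Prod.ext (funext h1) (Prod.ext ?_ (Prod.ext h3 h4))
    ext i
    simpa using h2 i

/-- The Hamiltonian vector field `X_F` on `T*Q`: the unique vector field with
`ω_Q(X_F, ·) = dF`. -/
def hamiltonianField (F : Phase → ℝ) (z : Phase) : TangentSpace IP z :=
  Classical.choose (canonicalForm_nondegenerate z (mfderiv IP 𝓘(ℝ, ℝ) F z)).exists

/-- A smooth map `T*Q → T*Q` preserving `ω_Q`. -/
structure IsSymplecticMap (ε : Phase → Phase) : Prop where
  smooth : ContMDiff IP IP ∞ ε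
  pullback : ∀ (z : Phase) (v w : TangentSpace IP z),
    canonicalForm (ε z) (mfderiv IP IP ε z v) (mfderiv IP IP ε z w) = canonicalForm z v w

/-- A smooth one-form on `Q`, seen as a section `Q → T*Q` of `π_Q`. -/
structure IsOneForm (γ : Config → Phase) : Prop where
  smooth : ContMDiff IQ IP ∞ γ
  section_eq : ∀ q, piQ (γ q) = q

/-! ### Momentum map and reduced space -/

/-- The momentum map `J_Q : T*Q → so*(3)` of the lifted left action,
`J_Q(A, Π, α, l) = Ad*_{A⁻¹} Π = A Π`. -/
def momentum (z : Phase) : R3 := (z.1 : Matrix (Fin 3) (Fin 3) ℝ) *ᵥ z.2.1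

/-- The level set `J_Q⁻¹(μ)`. -/
abbrev Level (μ : R3) : Type := {z : Phase // momentum z = μ}

/-- The coadjoint isotropy group `SO(3)_μ`. -/
def isotropy (μ : R3) : Set SO3 := {g | (g : Matrix (Fin 3) (Fin 3) ℝ) *ᵥ μ = μ}

/-- The coadjoint orbit `O_μ ⊆ so*(3)`. -/
def coadjointOrbit (μ : R3) : Set R3 :=
  Set.range fun g : SO3 => (g : Matrix (Fin 3) (Fin 3) ℝ) *ᵥ μ

/-- The reduced space `O_μ × ℝ × ℝ*`, a subset of `so*(3) × ℝ × ℝ*`. -/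
abbrev Reduced (μ : R3) : Type := {p : DualSpace // p.1 ∈ coadjointOrbit μ}

theorem snd_mem_coadjointOrbit {μ : R3} (z : Level μ) : z.1.2.1 ∈ coadjointOrbit μ := by
  refine ⟨z.1.1⁻¹, ?_⟩
  have h : ((z.1.1⁻¹ : SO3) : Matrix (Fin 3) (Fin 3) ℝ) *ᵥ momentum z.1 = z.1.2.1 := by
    rw [momentum, Matrix.mulVec_mulVec]
    have := congrArg Subtype.val (inv_mul_cancel z.1.1)
    rw [Submonoid.coe_mul] at this
    rw [this]
    simp
  rw [z.2] at h
  exact h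

/-- The reduction map `π_μ : J_Q⁻¹(μ) → O_μ × ℝ × ℝ*`, `(A, Π, α, l) ↦ (Π, α, l)`. -/
def piMu (μ : R3) (z : Level μ) : Reduced μ := ⟨z.1.2, snd_mem_coadjointOrbit z⟩

/-- The tangent space of `O_μ × ℝ × ℝ*` at `p = (ν, α, l)`: the vectors `(ad*_ξ ν, a, b)`,
where `ad*_ξ ν = ν × ξ`. -/
def reducedTangent (p : DualSpace) : Submodule ℝ DualSpace :=
  (LinearMap.range (crossProduct p.1)).prod ⊤

/-- The orbit symplectic form `ω⁻` at `ν`, as a form on the tangent plane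
`{ν × ξ}` of the coadjoint orbit through `ν`. -/
def orbitForm (ν x y : R3) : ℝ := -(ν ⬝ᵥ crossProduct x y) / (ν ⬝ᵥ ν)

/-- `ω⁻(ad*_ξ ν, ad*_η ν) = -⟨ν, [ξ, η]⟩`. -/
theorem orbitForm_ad (ν ξ η : R3) :
    orbitForm ν (crossProduct ν ξ) (crossProduct ν η) = -(ν ⬝ᵥ crossProduct ξ η) := by
  by_cases h : ν = 0
  · simp [h, orbitForm]
  · have h' : ν ⬝ᵥ ν ≠ 0 := by simpa [dotProduct_self_eq_zero] using h
    rw [orbitForm, div_eq_iff h']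
    simp only [dotProduct, Fin.sum_univ_three, cross_apply,
      Matrix.cons_val_zero, Matrix.cons_val_one, Matrix.cons_val]
    ring_nf

/-- The reduced symplectic form `π^* ω⁻ + π^* ω_ℝ` of `O_μ × ℝ × ℝ*`. -/
def reducedForm (p v w : DualSpace) : ℝ :=
  orbitForm p.1 v.1 w.1 + (v.2.1 * w.2.2 - v.2.2 * w.2.1)

theorem reducedForm_nondegenerate (p : DualSpace) (L : DualSpace →L[ℝ] ℝ) :
    ∃! X : reducedTangent p, ∀ w : reducedTangent p, reducedForm p X w = L w := by
  have hL : ∀ w : DualSpace, L w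
      = w.1 ⬝ᵥ (fun i => L (Pi.single i 1, 0, 0)) + w.2.1 * L (0, 1, 0) + w.2.2 * L (0, 0, 1) := by
    intro w
    have hw : w = w.1 0 • ((Pi.single 0 1 : R3), (0 : ℝ), (0 : ℝ))
        + w.1 1 • ((Pi.single 1 1 : R3), (0 : ℝ), (0 : ℝ))
        + w.1 2 • ((Pi.single 2 1 : R3), (0 : ℝ), (0 : ℝ))
        + w.2.1 • ((0 : R3), (1 : ℝ), (0 : ℝ))
        + w.2.2 • ((0 : R3), (0 : ℝ), (1 : ℝ)) := by
      refine Prod.ext ?_ (Prod.ext ?_ ?_)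
      · ext i; fin_cases i <;> simp
      · simp
      · simp
    conv_lhs => rw [hw]
    simp only [map_add, map_smul, smul_eq_mul, dotProduct, Fin.sum_univ_three]
  refine ⟨⟨(crossProduct p.1 (fun i => L (Pi.single i 1, 0, 0)), L (0, 0, 1), - L (0, 1, 0)),
    ⟨⟨_, rfl⟩, trivial⟩⟩, ?_, ?_⟩
  · rintro ⟨⟨x, a, b⟩, ⟨η, hη⟩, ht⟩
    obtain rfl : crossProduct p.1 η = x := hη
    rw [hL (crossProduct p.1 η, a, b)]
    simp only [reducedForm, orbitForm_ad]
    simp only [dotProduct, Fin.sum_univ_three, cross_apply,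
      Matrix.cons_val_zero, Matrix.cons_val_one, Matrix.cons_val]
    ring
  · rintro ⟨⟨x, a, b⟩, ⟨ξ, hξ⟩, ht⟩ hX
    obtain rfl : crossProduct p.1 ξ = x := hξ
    have h1 : ∀ η : R3, -(p.1 ⬝ᵥ crossProduct ξ η)
        = crossProduct p.1 η ⬝ᵥ (fun i => L (Pi.single i 1, 0, 0)) := by
      intro η
      have := hX ⟨(crossProduct p.1 η, 0, 0), ⟨η, rfl⟩, trivial⟩
      rw [hL] at this
      simpa [reducedForm, orbitForm_ad] using this
    have h2 : a = L (0, 0, 1) := by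
      simpa [reducedForm, orbitForm] using hX ⟨(0, 0, 1), ⟨0, by simp⟩, trivial⟩
    have h3 : b = - L (0, 1, 0) := by
      rw [← show -b = L (0, 1, 0) by
        simpa [reducedForm, orbitForm] using hX ⟨(0, 1, 0), ⟨0, by simp⟩, trivial⟩]
      simp
    refine Subtype.ext (Prod.ext ?_ (Prod.ext h2 h3))
    ext i
    have h := h1 (Pi.single i 1)
    fin_cases i <;>
      simp [cross_apply, dotProduct, Fin.sum_univ_three] at h ⊢ <;> linarith

/-- The Hamiltonian vector field on `O_μ × ℝ × ℝ*` of the restriction of `h`: at `p`, the unique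
tangent vector `X` with `ω⁻(X, w) = dh(w)` for all `w` tangent to `O_μ × ℝ × ℝ*` at `p`. -/
def reducedHamiltonianField (μ : R3) (h : DualSpace → ℝ) (p : Reduced μ) :
    reducedTangent (p : DualSpace) :=
  Classical.choose (reducedForm_nondegenerate (p : DualSpace) (fderiv ℝ h p)).exists

/-! ### The spacecraft-rotor system with coincident centers -/

/-- The moments of inertia: `I 0, I 1, I 2` of the carrier body, `J₃` of the rotor about its axis,
`J₃₁, J₃₂` of the rotor about the first two principal axes. -/
structure Inertia where
  I : Fin 3 → ℝ
  J₃ : ℝ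
  J₃₁ : ℝ
  J₃₂ : ℝ
  I_pos : ∀ k, 0 < I k
  J₃_pos : 0 < J₃
  J₃₁_nonneg : 0 ≤ J₃₁
  J₃₂_nonneg : 0 ≤ J₃₂

/-- `Ī₁ = I₁ + J₃₁`, `Ī₂ = I₂ + J₃₂`, `Ī₃ = I₃`. -/
def Inertia.bar (S : Inertia) : Fin 3 → ℝ := ![S.I 0 + S.J₃₁, S.I 1 + S.J₃₂, S.I 2]

/-- The energy as a function of `(Π, α, l)`; its restriction to `O_μ × ℝ × ℝ*` is the reduced
Hamiltonian `h_μ`. -/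
def Inertia.energy (S : Inertia) (p : DualSpace) : ℝ :=
  1 / 2 * (p.1 0 ^ 2 / S.bar 0 + p.1 1 ^ 2 / S.bar 1
    + (p.1 2 - p.2.2) ^ 2 / S.bar 2 + p.2.2 ^ 2 / S.J₃)

/-- The Hamiltonian `H(A, Π, α, l)`. -/
def Inertia.hamiltonian (S : Inertia) (z : Phase) : ℝ := S.energy z.2

/-- `h_μ ∘ π_μ = H ∘ i_μ`. -/
theorem Inertia.energy_piMu (S : Inertia) (μ : R3) (z : Level μ) :
    S.energy (piMu μ z) = S.hamiltonian z := rfl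

/-- An `SO(3)`-invariant control: a smooth fibre-preserving map `u : T*Q → T*Q` commuting with
the lifted action. -/
structure IsInvariantControl (u : Phase → Phase) : Prop where
  smooth : ContMDiff IP IP ∞ u
  fiber : ∀ z, piQ (u z) = piQ z
  invariant : ∀ g z, u (actP g z) = actP g (u z)

/-- The vertical lift of `u`: the velocity at `t = 0` of the curve `t ↦ z + t u(z)` in the fibre
of `T*Q` through `z`. -/
def vlift (u : Phase → Phase) (z : Phase) : TangentSpace IP z :=
  ((0, (u z).2.1, 0, (u z).2.2.2) : R3 × DualSpace)

/-- The dynamical vector field `X̃ = X_H + vlift(u)` of the controlled system. -/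
def dynamicalField (S : Inertia) (u : Phase → Phase) (z : Phase) : TangentSpace IP z :=
  hamiltonianField S.hamiltonian z + vlift u z

/-- `X̃^ε = Tπ_Q ∘ X̃ ∘ ε : T*Q → TQ`. -/
def fieldAlong (S : Inertia) (u ε : Phase → Phase) (z : Phase) : TangentBundle IQ Config :=
  tangentMap IP IQ piQ ⟨ε z, dynamicalField S u (ε z)⟩

/-- The Type II Hamilton-Jacobi equation `Tγ ∘ X̃^ε = X_H ∘ ε` at `z`, an equality
in `T(T*Q)`. -/
def TypeIIAt (S : Inertia) (u : Phase → Phase) (γ : Config → Phase) (ε : Phase → Phase)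
    (z : Phase) : Prop :=
  tangentMap IQ IP γ (fieldAlong S u ε z) = ⟨ε z, hamiltonianField S.hamiltonian (ε z)⟩

/-- `γ̄ = π_μ ∘ γ : Q → O_μ × ℝ × ℝ*`. -/
def gammaBar (μ : R3) (γ : Config → Phase) (hγ : ∀ q, momentum (γ q) = μ) (q : Config) :
    Reduced μ := piMu μ ⟨γ q, hγ q⟩

/-- `ε̄ = π_μ ∘ ε : J_Q⁻¹(μ) → O_μ × ℝ × ℝ*`. -/
def epsBar (μ : R3) (ε : Phase → Phase) (hε : ∀ z, momentum z = μ → momentum (ε z) = μ)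
    (z : Level μ) : Reduced μ := piMu μ ⟨ε z, hε z z.2⟩

/-- The reduced Type II Hamilton-Jacobi equation `Tγ̄ ∘ X̃^ε = X_{h_μ} ∘ ε̄` at `z ∈ J_Q⁻¹(μ)`,
an equality in `T(O_μ × ℝ × ℝ*) ⊆ T(so*(3) × ℝ × ℝ*)`. -/
def ReducedTypeIIAt (S : Inertia) (μ : R3) (u : Phase → Phase) (γ : Config → Phase)
    (hγ : ∀ q, momentum (γ q) = μ) (ε : Phase → Phase)
    (hε : ∀ z, momentum z = μ → momentum (ε z) = μ) (z : Level μ) : Prop :=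
  tangentMap IQ 𝓘(ℝ, DualSpace) (fun q => (gammaBar μ γ hγ q : DualSpace)) (fieldAlong S u ε z)
    = ⟨(epsBar μ ε hε z : DualSpace),
        (reducedHamiltonianField μ S.energy (epsBar μ ε hε z) : DualSpace)⟩

end

end SpacecraftRotor

open SpacecraftRotor

/-!
At a single point `z` of the level set, both Hamilton-Jacobi equations split into an equality of
base points and an equality of velocities, and the reduced equation is the unreduced one with the
`SO(3)`-components dropped. These components carry no information: `γ` is a section of `π_Q`, so
`γ (π_Q (ε z))` and `ε z` lie over the same point of `Q`, and `Tγ` preserves the horizontal part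
of a vector (`IsOneForm.mfderiv_fst`), which for `X̃ (ε z)` is that of `X_H (ε z)` because
`vlift u` is vertical (`dynamicalField_fst`). On the remaining components `X_H` projects to
`X_{h_μ}` (`hamiltonianField_snd`). This is `typeIIAt_iff_reducedTypeIIAt`.

For the global equivalence one direction is immediate. The other one cannot come from the pointwise
statement alone, since nothing relates the points off the level set to those on it. It holds because
neither global equation has a solution: the equation at every `z` of the level set forces
`ε z = γ (π_Q (ε z))` there, so the restriction of `ε` to the `5`-dimensional level set factors
through the `4`-dimensional `Q`, whereas a symplectic map is an immersion
(`not_forall_level_eq_section`).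
-/

namespace SpacecraftRotor

/-- Tangent spaces at different points are the same model space `E`, so tangent vectors of a
bundle are equal when base points and coordinates in `E` are. -/
theorem tangentBundle_ext_iff {E H M : Type*} [NormedAddCommGroup E] [NormedSpace ℝ E]
    [TopologicalSpace H] {I : ModelWithCorners ℝ E H} [TopologicalSpace M] [ChartedSpace H M]
    (p p' : TangentBundle I M) : p = p' ↔ p.1 = p'.1 ∧ (p.2 : E) = (p'.2 : E) := by
  constructor
  · rintro rfl
    exact ⟨rfl, rfl⟩
  · obtain ⟨x, v⟩ := p
    obtain ⟨y, w⟩ := p'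
    rintro ⟨rfl, h⟩
    exact congrArg _ h

/-! ### Reduction of the Hamiltonian vector field -/

theorem differentiable_energy (S : Inertia) : Differentiable ℝ S.energy := by
  unfold Inertia.energy
  fun_prop

theorem mfderiv_hamiltonian (S : Inertia) (z : Phase) (w : R3 × DualSpace) :
    mfderiv IP 𝓘(ℝ, ℝ) S.hamiltonian z w = fderiv ℝ S.energy z.2 w.2 := by
  have h := mfderiv_comp (I := IP) (I' := 𝓘(ℝ, DualSpace)) (I'' := 𝓘(ℝ, ℝ)) z
    (g := S.energy) (f := Prod.snd) (differentiable_energy S z.2).mdifferentiableAt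
    mdifferentiableAt_snd
  have h' : S.hamiltonian = S.energy ∘ Prod.snd := rfl
  rw [h', h, mfderiv_snd, mfderiv_eq_fderiv]
  rfl

theorem hamiltonianField_spec (S : Inertia) (z : Phase) (w : R3 × DualSpace) :
    canonicalForm z (hamiltonianField S.hamiltonian z) w = fderiv ℝ S.energy z.2 w.2 :=
  (Classical.choose_spec
    (canonicalForm_nondegenerate z (mfderiv IP 𝓘(ℝ, ℝ) S.hamiltonian z)).exists w).trans
    (mfderiv_hamiltonian S z w)

/-- The first half of the defining equation of `X_H`, for `H` independent of the attitude `A`: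
the Euler equation `Π' = Π × Ω`. In particular `Π'` is tangent to the coadjoint orbit. -/
theorem hamiltonianField_momentum_part (S : Inertia) (z : Phase) (X : R3 × DualSpace)
    (hX : ∀ w, canonicalForm z X w = fderiv ℝ S.energy z.2 w.2) :
    X.2.1 = crossProduct z.2.1 X.1 := by
  ext i
  have h := hX (Pi.single i 1, 0)
  fin_cases i <;>
    simp [canonicalForm, cross_apply, dotProduct, Fin.sum_univ_three] at h ⊢ <;> linarith

/-- `X_H` is `π_μ`-related to `X_{h_μ}`: the `(Π, α, l)`-part of `X_H` is tangent to the reduced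
space and satisfies the equation that determines `X_{h_μ}`. -/
theorem hamiltonianField_snd (S : Inertia) (μ : R3) (z : Phase) (p : Reduced μ)
    (hp : (p : DualSpace) = z.2) :
    (hamiltonianField S.hamiltonian z : R3 × DualSpace).2
      = (reducedHamiltonianField μ S.energy p : DualSpace) := by
  obtain ⟨p, hpo⟩ := p
  obtain rfl : p = z.2 := hp
  set X : R3 × DualSpace := hamiltonianField S.hamiltonian z with hXdef
  have hX : ∀ w, canonicalForm z X w = fderiv ℝ S.energy z.2 w.2 := hamiltonianField_spec S z
  have hm := hamiltonianField_momentum_part S z X hX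
  have hmem : X.2 ∈ reducedTangent z.2 := ⟨⟨X.1, hm.symm⟩, trivial⟩
  refine congrArg Subtype.val (a₁ := (⟨X.2, hmem⟩ : reducedTangent z.2))
    ((reducedForm_nondegenerate z.2 (fderiv ℝ S.energy z.2)).unique ?_
      (Classical.choose_spec (reducedForm_nondegenerate z.2 (fderiv ℝ S.energy z.2)).exists))
  rintro ⟨⟨x, a, b⟩, ⟨η, hη⟩, -⟩
  obtain rfl : crossProduct z.2.1 η = x := hη
  -- A reduced tangent vector is tested against its lift with zero `SO(3)`-component.
  have h := hX (0, crossProduct z.2.1 η, a, b)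
  rw [← h]
  simp only [reducedForm, hm, orbitForm_ad]
  simp [canonicalForm, cross_apply, dotProduct, Fin.sum_univ_three]
  ring

/-! ### The pointwise equivalence -/

theorem mfderiv_piQ (z : Phase) (v : R3 × DualSpace) :
    (mfderiv IP IQ piQ z v : R3 × ℝ) = (v.1, v.2.2.1) := by
  have h1 : HasMFDerivAt IP 𝓘(ℝ, R3) (Prod.fst : Phase → SO3) z
    (ContinuousLinearMap.fst ℝ R3 DualSpace) := hasMFDerivAt_fst z
  have h2 : HasMFDerivAt IP 𝓘(ℝ, DualSpace) (Prod.snd : Phase → DualSpace) z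
    (ContinuousLinearMap.snd ℝ R3 DualSpace) := hasMFDerivAt_snd z
  have h3 := ((ContinuousLinearMap.fst ℝ ℝ ℝ).comp
    (ContinuousLinearMap.snd ℝ R3 (ℝ × ℝ))).hasMFDerivAt (x := z.2)
  have h4 := h1.prodMk (h3.comp z h2)
  have h5 : HasMFDerivAt IP IQ piQ z _ := h4
  rw [h5.mfderiv]
  rfl

theorem mdifferentiable_piQ : MDifferentiable IP IQ piQ := by
  intro z
  have h2 : MDifferentiableAt IP 𝓘(ℝ, DualSpace) (Prod.snd : Phase → DualSpace) z :=
    mdifferentiableAt_snd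
  exact MDifferentiableAt.prodMk (mdifferentiableAt_fst : MDifferentiableAt IP 𝓘(ℝ, R3) _ z)
    (((ContinuousLinearMap.fst ℝ ℝ ℝ).comp
    (ContinuousLinearMap.snd ℝ R3 (ℝ × ℝ))).mdifferentiableAt.comp z h2)

theorem IsOneForm.mdifferentiable {γ : Config → Phase} (hγ : IsOneForm γ) :
    MDifferentiable IQ IP γ :=
  hγ.smooth.mdifferentiable (by simp)

/-- A one-form is a section of `π_Q`, so its derivative does not change the horizontal part. -/
theorem IsOneForm.mfderiv_fst {γ : Config → Phase} (hγ : IsOneForm γ) (q : Config)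
    (v : R3 × ℝ) : (mfderiv IQ IP γ q v : R3 × DualSpace).1 = v.1 := by
  have h := mfderiv_comp q (mdifferentiable_piQ (γ q)) (hγ.mdifferentiable q)
  have hid : piQ ∘ γ = id := funext hγ.section_eq
  rw [hid, mfderiv_id] at h
  have hv : (v : R3 × ℝ) = (mfderiv IP IQ piQ (γ q) (mfderiv IQ IP γ q v) : R3 × ℝ) :=
    DFunLike.congr_fun h v
  exact (congrArg Prod.fst (hv.trans (mfderiv_piQ _ _))).symm

theorem IsOneForm.mfderiv_snd {γ : Config → Phase} (hγ : IsOneForm γ) (q : Config)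
    (v : R3 × ℝ) : (mfderiv IQ IP γ q v : R3 × DualSpace).2
      = mfderiv IQ 𝓘(ℝ, DualSpace) (fun q => (γ q).2) q v := by
  have h := mfderiv_comp (I := IQ) (I' := IP) (I'' := 𝓘(ℝ, DualSpace)) q
    (g := Prod.snd) mdifferentiableAt_snd (hγ.mdifferentiable q)
  have h' : (fun q => (γ q).2) = Prod.snd ∘ γ := rfl
  rw [h', h, _root_.mfderiv_snd]
  rfl

/-- The controls act by vertical vectors, so `X̃` and `X_H` have the same angular velocity. -/
theorem dynamicalField_fst (S : Inertia) (u : Phase → Phase) (z : Phase) :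
    (dynamicalField S u z : R3 × DualSpace).1
      = (hamiltonianField S.hamiltonian z : R3 × DualSpace).1 := by
  change (hamiltonianField S.hamiltonian z : R3 × DualSpace).1 + 0 = _
  exact add_zero _

theorem typeIIAt_iff_reducedTypeIIAt (S : Inertia) (μ : R3) (u : Phase → Phase)
    {γ : Config → Phase} (hγ : IsOneForm γ) (hγμ : ∀ q, momentum (γ q) = μ)
    (ε : Phase → Phase) (hεμ : ∀ z, momentum z = μ → momentum (ε z) = μ) (z : Level μ) :
    TypeIIAt S u γ ε z ↔ ReducedTypeIIAt S μ u γ hγμ ε hεμ z := by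
  set q := piQ (ε z)
  set v : R3 × ℝ := mfderiv IP IQ piQ (ε z) (dynamicalField S u (ε z))
  have hv1 : v.1 = (hamiltonianField S.hamiltonian (ε z) : R3 × DualSpace).1 :=
    (congrArg Prod.fst (mfderiv_piQ _ _)).trans (dynamicalField_fst S u (ε z))
  have hL : TypeIIAt S u γ ε z ↔ γ q = ε z ∧ (mfderiv IQ IP γ q v : R3 × DualSpace)
      = (hamiltonianField S.hamiltonian (ε z) : R3 × DualSpace) :=
    tangentBundle_ext_iff _ _
  have hR : ReducedTypeIIAt S μ u γ hγμ ε hεμ z ↔ (γ q).2 = (ε z).2 ∧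
      (mfderiv IQ 𝓘(ℝ, DualSpace) (fun q => (γ q).2) q v : DualSpace)
        = (reducedHamiltonianField μ S.energy (epsBar μ ε hεμ z) : DualSpace) :=
    tangentBundle_ext_iff _ _
  have hbase : γ q = ε z ↔ (γ q).2 = (ε z).2 := by
    refine ⟨congrArg Prod.snd, fun h => Prod.ext ?_ h⟩
    have hs : piQ (γ q) = q := hγ.section_eq q
    exact congrArg (Prod.fst : Config → SO3) hs
  rw [hL, hR, hbase, ← hγ.mfderiv_snd, ← hamiltonianField_snd S μ (ε z) (epsBar μ ε hεμ z) rfl]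
  refine and_congr_right fun _ => ⟨congrArg Prod.snd, fun h => Prod.ext ?_ h⟩
  exact (hγ.mfderiv_fst q v).trans hv1

/-! ### The level set is too large to be carried into the image of a one-form -/

/-- The level set `J_Q⁻¹(μ)`, parametrized by `(A, α, l) ↦ (A, A⁻¹μ, α, l)`. -/
noncomputable def levelParam (μ : R3) (x : SO3 × ℝ × ℝ) : Phase :=
  (x.1, ((x.1 : Matrix (Fin 3) (Fin 3) ℝ))ᵀ *ᵥ μ, x.2)

theorem momentum_levelParam (μ : R3) (x : SO3 × ℝ × ℝ) : momentum (levelParam μ x) = μ := by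
  have h := (Matrix.mem_orthogonalGroup_iff _ _).1
    (Matrix.mem_specialOrthogonalGroup_iff.1 x.1.2).1
  rw [momentum, levelParam, Matrix.mulVec_mulVec]
  exact (congrArg (· *ᵥ μ) h).trans (Matrix.one_mulVec μ)

theorem mdifferentiable_entry (i j : Fin 3) : MDifferentiable 𝓘(ℝ, R3) 𝓘(ℝ, ℝ)
    (fun B : SO3 => (B : Matrix (Fin 3) (Fin 3) ℝ) i j) := by
  intro A
  rw [mdifferentiableAt_iff]
  refine ⟨(Continuous.matrix_elem continuous_subtype_val i j).continuousAt, ?_⟩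
  have h : Differentiable ℝ
      (fun x : R3 => ((A : Matrix (Fin 3) (Fin 3) ℝ) * cayleyMatrix x) i j) := by
    simp only [Matrix.mul_apply]
    exact Differentiable.fun_sum fun k _ =>
      ((contDiff_cayleyMatrix k j).differentiable (by simp)).const_mul _
  exact (h _).differentiableWithinAt

/-- The model with corners of `SO(3) × ℝ × ℝ*`. -/
noncomputable abbrev levelModel : ModelWithCorners ℝ (R3 × ℝ × ℝ) (ModelProd R3 (ℝ × ℝ)) :=
  𝓘(ℝ, R3).prod 𝓘(ℝ, ℝ × ℝ)

theorem mdifferentiable_levelParam (μ : R3) : MDifferentiable levelModel IP (levelParam μ) := by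
  intro x
  have h1 : MDifferentiableAt levelModel 𝓘(ℝ, R3) (Prod.fst : SO3 × ℝ × ℝ → SO3) x :=
    mdifferentiableAt_fst
  have h2 : MDifferentiableAt levelModel 𝓘(ℝ, ℝ × ℝ) (Prod.snd : SO3 × ℝ × ℝ → ℝ × ℝ) x :=
    mdifferentiableAt_snd
  have h3 : MDifferentiableAt 𝓘(ℝ, R3) 𝓘(ℝ, R3)
      (fun A : SO3 => ((A : Matrix (Fin 3) (Fin 3) ℝ))ᵀ *ᵥ μ) x.1 := by
    have hi : ∀ i, MDifferentiableAt 𝓘(ℝ, R3) 𝓘(ℝ, ℝ)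
        (fun A : SO3 => (((A : Matrix (Fin 3) (Fin 3) ℝ))ᵀ *ᵥ μ) i) x.1 := by
      intro i
      have : (fun A : SO3 => ((((A : Matrix (Fin 3) (Fin 3) ℝ))ᵀ *ᵥ μ) i : ℝ))
          = fun A : SO3 => (A : Matrix (Fin 3) (Fin 3) ℝ) 0 i * μ 0
            + (A : Matrix (Fin 3) (Fin 3) ℝ) 1 i * μ 1
            + (A : Matrix (Fin 3) (Fin 3) ℝ) 2 i * μ 2 := by
        ext A
        simp [Matrix.mulVec, dotProduct, Fin.sum_univ_three]
      rw [this]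
      exact (((mdifferentiable_entry 0 i x.1).mul mdifferentiableAt_const).add
        ((mdifferentiable_entry 1 i x.1).mul mdifferentiableAt_const)).add
        ((mdifferentiable_entry 2 i x.1).mul mdifferentiableAt_const)
    rw [mdifferentiableAt_iff]
    exact ⟨continuousAt_pi.2 fun i => (hi i).continuousAt,
      differentiableWithinAt_pi.2 fun i => ((mdifferentiableAt_iff _ _).1 (hi i)).2⟩
  exact h1.prodMk ((h3.comp x h1).prodMk_space h2)

theorem mfderiv_levelParam_injective (μ : R3) (x : SO3 × ℝ × ℝ) :
    Function.Injective (mfderiv levelModel IP (levelParam μ) x) := by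
  have h1 : MDifferentiable IP 𝓘(ℝ, R3) (Prod.fst : Phase → SO3) := fun _ =>
    mdifferentiableAt_fst
  have h2 : MDifferentiable IP 𝓘(ℝ, DualSpace) (Prod.snd : Phase → DualSpace) := fun _ =>
    mdifferentiableAt_snd
  have hr : MDifferentiable IP levelModel (fun z : Phase => ((z.1, z.2.2) : SO3 × ℝ × ℝ)) :=
    fun z => (h1 z).prodMk
      ((ContinuousLinearMap.snd ℝ R3 (ℝ × ℝ)).mdifferentiableAt.comp z (h2 z))
  have h := mfderiv_comp x (hr (levelParam μ x)) (mdifferentiable_levelParam μ x)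
  have hid : (fun z : Phase => ((z.1, z.2.2) : SO3 × ℝ × ℝ)) ∘ levelParam μ = id := rfl
  rw [hid, mfderiv_id] at h
  -- The parametrization has the smooth left inverse `(A, Π, α, l) ↦ (A, α, l)`.
  refine Function.LeftInverse.injective (g := mfderiv IP levelModel
    (fun z : Phase => ((z.1, z.2.2) : SO3 × ℝ × ℝ)) (levelParam μ x)) fun v => ?_
  exact (DFunLike.congr_fun h v).symm

/-- A symplectic map is an immersion, by nondegeneracy of `ω_Q`. -/
theorem IsSymplecticMap.mfderiv_injective {ε : Phase → Phase} (hε : IsSymplecticMap ε)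
    (z : Phase) : Function.Injective (mfderiv IP IP ε z) := by
  refine (injective_iff_map_eq_zero _).2 fun v hv => ?_
  have h0 : ∀ w : R3 × DualSpace, canonicalForm z 0 w = 0 := fun w => by simp [canonicalForm]
  have h1 : ∀ w : R3 × DualSpace, canonicalForm z v w = 0 := fun w => by
    rw [← hε.pullback z v w, hv]
    exact (by simp [canonicalForm] : canonicalForm (ε z) 0 (mfderiv IP IP ε z w) = 0)
  exact (canonicalForm_nondegenerate z 0).unique h1 h0

/-- The level set has dimension `5` and `Q` has dimension `4`, so an immersion of phase space
cannot map the level set into the image of a one-form. -/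
theorem not_forall_level_eq_section (μ : R3) {γ : Config → Phase} (hγ : IsOneForm γ)
    {ε : Phase → Phase} (hε : IsSymplecticMap ε) :
    ¬ ∀ z : Level μ, γ (piQ (ε z)) = ε z := by
  intro h
  set x : SO3 × ℝ × ℝ := (1, 0)
  have hεd : MDifferentiable IP IP ε := hε.smooth.mdifferentiable (by simp)
  have hc := mdifferentiable_levelParam μ x
  have hεc := (hεd (levelParam μ x)).comp x hc
  have hp : MDifferentiableAt levelModel IQ (piQ ∘ (ε ∘ levelParam μ)) x :=
    (mdifferentiable_piQ _).comp x hεc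
  have hfac : ε ∘ levelParam μ = γ ∘ (piQ ∘ (ε ∘ levelParam μ)) :=
    funext fun y => (h ⟨levelParam μ y, momentum_levelParam μ y⟩).symm
  have hd := mfderiv_comp x (hγ.mdifferentiable _) hp
  rw [← hfac, mfderiv_comp x (hεd (levelParam μ x)) hc] at hd
  let T : (R3 × ℝ × ℝ) →L[ℝ] (R3 × ℝ) := mfderiv levelModel IQ (piQ ∘ (ε ∘ levelParam μ)) x
  have hT : Function.Injective T := by
    intro v w hvw
    apply mfderiv_levelParam_injective μ x
    apply hε.mfderiv_injective (levelParam μ x)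
    exact (DFunLike.congr_fun hd v).trans
      ((congrArg (mfderiv IQ IP γ ((piQ ∘ (ε ∘ levelParam μ)) x)) hvw).trans
        (DFunLike.congr_fun hd w).symm)
  -- The dimensions are `3 + 1 + 1` and `3 + 1`.
  have hle := LinearMap.finrank_le_finrank_of_injective (f := T.toLinearMap) hT
  simp at hle

theorem not_forall_typeIIAt_level (S : Inertia) (μ : R3) (u : Phase → Phase) {γ : Config → Phase}
    (hγ : IsOneForm γ) {ε : Phase → Phase} (hε : IsSymplecticMap ε) :
    ¬ ∀ z : Level μ, TypeIIAt S u γ ε z := fun h =>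
  not_forall_level_eq_section μ hγ hε fun z => congrArg Bundle.TotalSpace.proj (h z)

end SpacecraftRotor

theorem theorem4p4 (S : Inertia) (μ : R3)
    (u : Phase → Phase) (hu : IsInvariantControl u)
    (γ : Config → Phase) (hγ : IsOneForm γ)
    (hγμ : ∀ q, momentum (γ q) = μ)
    (hγinv : ∀ g ∈ isotropy μ, ∀ q, γ (actQ g q) = actP g (γ q))
    (ε : Phase → Phase) (hε : IsSymplecticMap ε)
    (hεinv : ∀ g ∈ isotropy μ, ∀ z, ε (actP g z) = actP g (ε z))
    (hεμ : ∀ z, momentum z = μ → momentum (ε z) = μ) :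
    ((∀ z : Phase, TypeIIAt S u γ ε z) ↔
      (∀ z : Level μ, ReducedTypeIIAt S μ u γ hγμ ε hεμ z)) ∧
    (∀ z : Level μ, TypeIIAt S u γ ε z ↔ ReducedTypeIIAt S μ u γ hγμ ε hεμ z) := by
  have hpt := typeIIAt_iff_reducedTypeIIAt S μ u hγ hγμ ε hεμ
  refine ⟨⟨fun h z => (hpt z).1 (h z), fun h => ?_⟩, hpt⟩
  exact absurd (fun z => (hpt z).2 (h z)) (not_forall_typeIIAt_level S μ u hγ hε)
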